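/- Let $\mathbb{H}^3=\mathrm{SL}_2(\mathbb{C})/\mathrm{SU}(2)$ with its invariant Riemannian metric of constant curvature $-1$, so that the distance $d$ satisfies $\cosh d(\varkappa(A),\varkappa(B))=\tfrac12\operatorname{tr}\big((AA^*)^{-1}BB^*\big)$, where $\varkappa\colon \mathrm{SL}_2(\mathbb{C})\to\mathbb{H}^3$ is the quotient map, and let $O=\varkappa(\mathrm{Id})$. For $s>0$ let $R_s\colon\mathbb{H}^3\to\mathbb{H}^3$ be the rescaling centred at $O$ with factor $s^{-1}$: $R_s(O)=O$, and if $P\neq O$ has distance $t$ from $O$ and $\gamma\colon\mathbb{R}\to\mathbb{H}^3$ is the unit-speed geodesic with $\gamma(0)=O$ and $\gamma(t)=P$, then $R_s(P)=\gamma(s^{-1}t)$. A complex analytic surface in $\mathrm{SL}_2(\mathbb{C})$ is a subset $V$ such that every $Z\in V$ has an open neighbourhood $U\subset \mathrm{SL}_2(\mathbb{C})$ with a holomorphic function $F\colon U\to\mathbb{C}$ satisfying $V\cap U=F^{-1}(0)$. A sequence of subsets $A_n\subset\mathbb{H}^3$ is said to go to infinity if for every $r>0$ the open ball $B_r(O)$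 is disjoint from $A_n$ for all sufficiently large $n$. It is said to Hausdorff-converge to a non-empty closed set $L\subset\mathbb{H}^3$ if for all $R,\varepsilon>0$ and all sufficiently large $n$, the set $A_n\cap\overline{B_R(O)}$ is contained in the $\varepsilon$-neighbourhood of $L$ and the set $L\cap\overline{B_R(O)}$ is contained in the $\varepsilon$-neighbourhood of $A_n$ (Hausdorff convergence on bounded regions). **Theorem.** Let $(s_n)_n$ be a sequence of positive real numbers with $s_n\to+\infty$, and let $(V_n)_n$ be a sequence of closed complex analytic surfaces in $\mathrm{SL}_2(\mathbb{C})$. Then either the sequence $R_{s_n}(\varkappa(V_n))$ goes to infinity, or it has a Hausdorff-convergent subsequence, and the limit of every Hausdorff-convergent subsequence is the complement $\mathbb{H}^3\setminus B_r(O)$ of an open ball centred at $O$ of some radius $r\in[0,\infty)$ (for $r=0$ the ball is empty and the limit is all of $\mathbb{H}^3$). -/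

import Mathlib

open Filter Topology Set

/-- The group `SL₂(ℂ)`, with the topology induced from the space of complex `2 × 2` matrices. -/
abbrev SL2C : Type := Matrix.SpecialLinearGroup (Fin 2) ℂ

/-- The subgroup `SU(2)` of `SL₂(ℂ)`. -/
def SU2 : Subgroup SL2C where
  carrier := {A | (A : Matrix (Fin 2) (Fin 2) ℂ) ∈ Matrix.unitaryGroup (Fin 2) ℂ}
  one_mem' := one_mem (Matrix.unitaryGroup (Fin 2) ℂ)
  mul_mem' := by
    intro A B hA hB
    exact (Matrix.unitaryGroup (Fin 2) ℂ).mul_mem hA hB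
  inv_mem' := by
    intro A hA
    have h1 : (A : Matrix (Fin 2) (Fin 2) ℂ) * star (A : Matrix (Fin 2) (Fin 2) ℂ) = 1 :=
      (Unitary.mem_iff.mp hA).2
    have h2 : ((A⁻¹ : SL2C) : Matrix (Fin 2) (Fin 2) ℂ) * (A : Matrix (Fin 2) (Fin 2) ℂ) = 1 := by
      rw [← Matrix.SpecialLinearGroup.coe_mul]; simp
    have h3 : ((A⁻¹ : SL2C) : Matrix (Fin 2) (Fin 2) ℂ) = star (A : Matrix (Fin 2) (Fin 2) ℂ) :=
      left_inv_eq_right_inv h2 h1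
    change ((A⁻¹ : SL2C) : Matrix (Fin 2) (Fin 2) ℂ) ∈ Matrix.unitaryGroup (Fin 2) ℂ
    rw [h3]
    exact Unitary.star_mem hA

/-- Hyperbolic three-space, as the space of cosets `SL₂(ℂ) / SU(2)`. -/
def HypSpace : Type := SL2C ⧸ SU2

namespace HypSpace

/-- The quotient map `ϰ : SL₂(ℂ) → ℍ³`. -/
def kappa (A : SL2C) : HypSpace := (QuotientGroup.mk A : SL2C ⧸ SU2)

/-- The base point `O = ϰ(Id)`. -/
def base : HypSpace := kappa 1

theorem kappa_eq_iff (A B : SL2C) :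
    kappa A = kappa B ↔
      (A : Matrix (Fin 2) (Fin 2) ℂ) * (A : Matrix (Fin 2) (Fin 2) ℂ).conjTranspose =
        (B : Matrix (Fin 2) (Fin 2) ℂ) * (B : Matrix (Fin 2) (Fin 2) ℂ).conjTranspose := by
  have key : ∀ C : SL2C, C ∈ SU2 ↔
      (C : Matrix (Fin 2) (Fin 2) ℂ) * (C : Matrix (Fin 2) (Fin 2) ℂ).conjTranspose = 1 :=
    fun C => Matrix.mem_unitaryGroup_iff
  have h : kappa A = kappa B ↔ A⁻¹ * B ∈ SU2 := QuotientGroup.eq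
  rw [h, key]
  have hA : (A : Matrix (Fin 2) (Fin 2) ℂ) * ((A⁻¹ : SL2C) : Matrix (Fin 2) (Fin 2) ℂ) = 1 := by
    rw [← Matrix.SpecialLinearGroup.coe_mul]; simp
  have hA' : ((A⁻¹ : SL2C) : Matrix (Fin 2) (Fin 2) ℂ) * (A : Matrix (Fin 2) (Fin 2) ℂ) = 1 := by
    rw [← Matrix.SpecialLinearGroup.coe_mul]; simp
  rw [Matrix.SpecialLinearGroup.coe_mul, Matrix.conjTranspose_mul]
  set a := (A : Matrix (Fin 2) (Fin 2) ℂ)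
  set b := (B : Matrix (Fin 2) (Fin 2) ℂ)
  set c := ((A⁻¹ : SL2C) : Matrix (Fin 2) (Fin 2) ℂ)
  have hc : c.conjTranspose * a.conjTranspose = 1 := by
    rw [← Matrix.conjTranspose_mul, hA, Matrix.conjTranspose_one]
  have hc' : a.conjTranspose * c.conjTranspose = 1 := by
    rw [← Matrix.conjTranspose_mul, hA', Matrix.conjTranspose_one]
  constructor
  · intro e
    calc a * a.conjTranspose = a * (c * b * (b.conjTranspose * c.conjTranspose)) *
          a.conjTranspose := by rw [e, mul_one]
      _ = (a * c) * b * b.conjTranspose * (c.conjTranspose * a.conjTranspose) := by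
          simp only [mul_assoc]
      _ = b * b.conjTranspose := by rw [hA, hc, one_mul, mul_one]
  · intro e
    calc c * b * (b.conjTranspose * c.conjTranspose)
        = c * (b * b.conjTranspose) * c.conjTranspose := by simp only [mul_assoc]
      _ = (c * a) * (a.conjTranspose * c.conjTranspose) := by rw [← e]; simp only [mul_assoc]
      _ = 1 := by rw [hA', hc', one_mul]

/-- The positive definite Hermitian matrix `A Aᴴ` of determinant one which represents the point
`ϰ(A)`. -/
def herm (P : HypSpace) : Matrix (Fin 2) (Fin 2) ℂ :=
  Quotient.liftOn' (s₁ := QuotientGroup.leftRel SU2) P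
    (fun A : SL2C =>
      (A : Matrix (Fin 2) (Fin 2) ℂ) * (A : Matrix (Fin 2) (Fin 2) ℂ).conjTranspose)
    (fun A B h => (kappa_eq_iff A B).mp (Quotient.sound' h))

@[simp] theorem herm_kappa (A : SL2C) :
    herm (kappa A) =
      (A : Matrix (Fin 2) (Fin 2) ℂ) * (A : Matrix (Fin 2) (Fin 2) ℂ).conjTranspose := rfl

theorem kappa_surjective : Function.Surjective kappa :=
  fun P => Quotient.inductionOn' P fun A => ⟨A, rfl⟩

theorem herm_injective : Function.Injective herm := by
  intro P Q h
  obtain ⟨A, rfl⟩ := kappa_surjective P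
  obtain ⟨B, rfl⟩ := kappa_surjective Q
  exact (kappa_eq_iff A B).mpr h

/-- Minkowski coordinates: `herm P = x₀ + x₁ σ₁ + x₂ σ₂ + x₃ σ₃` with Hermitian matrices `σᵢ`. -/
noncomputable def x0 (P : HypSpace) : ℝ := ((herm P 0 0).re + (herm P 1 1).re) / 2
/-- See `HypSpace.x0`. -/
noncomputable def x1 (P : HypSpace) : ℝ := (herm P 0 1).re
/-- See `HypSpace.x0`. -/
noncomputable def x2 (P : HypSpace) : ℝ := (herm P 0 1).im
/-- See `HypSpace.x0`. -/
noncomputable def x3 (P : HypSpace) : ℝ := ((herm P 0 0).re - (herm P 1 1).re) / 2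

theorem herm_eq (P : HypSpace) :
    herm P = !![((x0 P + x3 P : ℝ) : ℂ), ⟨x1 P, x2 P⟩; ⟨x1 P, -x2 P⟩, ((x0 P - x3 P : ℝ) : ℂ)] := by
  obtain ⟨A, rfl⟩ := kappa_surjective P
  ext i j
  fin_cases i <;> fin_cases j <;> apply Complex.ext <;>
    simp [x0, x1, x2, x3, Matrix.mul_apply, Fin.sum_univ_two] <;> ring

theorem herm_det (P : HypSpace) : (herm P).det = 1 := by
  obtain ⟨A, rfl⟩ := kappa_surjective P
  simp

theorem mink_self (P : HypSpace) : x0 P ^ 2 = 1 + (x1 P ^ 2 + x2 P ^ 2 + x3 P ^ 2) := by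
  have h := herm_det P
  rw [herm_eq, Matrix.det_fin_two_of] at h
  have := congrArg Complex.re h
  simp at this
  nlinarith [this]

theorem x0_pos (P : HypSpace) : 1 ≤ x0 P := by
  have h0 : 0 ≤ x0 P := by
    obtain ⟨A, rfl⟩ := kappa_surjective P
    have : ∀ z : ℂ, 0 ≤ z.re * z.re + z.im * z.im := fun z => add_nonneg (mul_self_nonneg _) (mul_self_nonneg _)
    simp [x0, Matrix.mul_apply, Fin.sum_univ_two]
    linarith [this (A 0 0), this (A 0 1), this (A 1 0), this (A 1 1)]
  nlinarith [mink_self P, sq_nonneg (x1 P), sq_nonneg (x2 P), sq_nonneg (x3 P)]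

theorem ext_coord {P Q : HypSpace} (h1 : x1 P = x1 Q) (h2 : x2 P = x2 Q) (h3 : x3 P = x3 Q) :
    P = Q := by
  have h0 : x0 P = x0 Q := by
    have hP := mink_self P
    have hQ := mink_self Q
    rw [h1, h2, h3, ← hQ] at hP
    exact (sq_eq_sq₀ (by linarith [x0_pos P]) (by linarith [x0_pos Q])).mp hP
  apply herm_injective
  rw [herm_eq P, herm_eq Q, h0, h1, h2, h3]

/-- The hyperbolic cosine of the distance: `½ tr (X⁻¹ Y)` for the Hermitian matrices `X`, `Y`
representing the two points. This is the Minkowski product of `X` and `Y`, viewed as points of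
the hyperboloid `det = 1`. -/
noncomputable def coshDist (P Q : HypSpace) : ℝ := ((herm P)⁻¹ * herm Q).trace.re / 2

theorem coshDist_eq (P Q : HypSpace) :
    coshDist P Q = x0 P * x0 Q - (x1 P * x1 Q + x2 P * x2 Q + x3 P * x3 Q) := by
  have : (herm P)⁻¹ = (herm P).adjugate := by simp [Matrix.inv_def, herm_det]
  rw [coshDist, this, herm_eq P, herm_eq Q, Matrix.adjugate_fin_two_of]
  simp [Matrix.trace_fin_two]
  ring

theorem cauchy (a b c d e f : ℝ) :
    |a * d + b * e + c * f| ≤ √(a ^ 2 + b ^ 2 + c ^ 2) * √(d ^ 2 + e ^ 2 + f ^ 2) := by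
  rw [← Real.sqrt_mul (by positivity)]
  apply Real.abs_le_sqrt
  nlinarith [sq_nonneg (a * e - b * d), sq_nonneg (a * f - c * d), sq_nonneg (b * f - c * e)]

theorem one_le_coshDist (P Q : HypSpace) : 1 ≤ coshDist P Q := by
  rw [coshDist_eq]
  have hP := mink_self P
  have hQ := mink_self Q
  have h1 := x0_pos P
  have h2 := x0_pos Q
  have hsq : (1 + (x1 P * x1 Q + x2 P * x2 Q + x3 P * x3 Q)) ^ 2 ≤ (x0 P * x0 Q) ^ 2 := by
    rw [mul_pow, hP, hQ]
    nlinarith [sq_nonneg (x1 P * x2 Q - x2 P * x1 Q), sq_nonneg (x1 P * x3 Q - x3 P * x1 Q),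
      sq_nonneg (x2 P * x3 Q - x3 P * x2 Q), sq_nonneg (x1 P - x1 Q), sq_nonneg (x2 P - x2 Q),
      sq_nonneg (x3 P - x3 Q)]
  have := abs_le_of_sq_le_sq' hsq (mul_nonneg (by linarith) (by linarith))
  linarith [this.2]

/-- Left translation of `SL₂(ℂ) / SU(2)`. -/
def translate (A : SL2C) (P : HypSpace) : HypSpace :=
  Quotient.liftOn' (s₁ := QuotientGroup.leftRel SU2) P (fun B : SL2C => kappa (A * B))
    (fun B C h => by
      have h' := (kappa_eq_iff B C).mp (Quotient.sound' h)
      rw [kappa_eq_iff]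
      simp only [Matrix.SpecialLinearGroup.coe_mul, Matrix.conjTranspose_mul]
      calc _ = (A : Matrix (Fin 2) (Fin 2) ℂ) * (B * (B : Matrix (Fin 2) (Fin 2) ℂ).conjTranspose) *
              (A : Matrix (Fin 2) (Fin 2) ℂ).conjTranspose := by simp only [mul_assoc]
        _ = _ := by rw [h']; simp only [mul_assoc])

@[simp] theorem translate_kappa (A B : SL2C) : translate A (kappa B) = kappa (A * B) := rfl

theorem coshDist_translate (A : SL2C) (P Q : HypSpace) :
    coshDist (translate A P) (translate A Q) = coshDist P Q := by
  obtain ⟨B, rfl⟩ := kappa_surjective P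
  obtain ⟨C, rfl⟩ := kappa_surjective Q
  simp only [translate_kappa, coshDist, herm_kappa, Matrix.SpecialLinearGroup.coe_mul,
    Matrix.conjTranspose_mul]
  have hA : IsUnit (A : Matrix (Fin 2) (Fin 2) ℂ).det := by simp
  have hA' : IsUnit (A : Matrix (Fin 2) (Fin 2) ℂ).conjTranspose.det := by
    simp [Matrix.det_conjTranspose]
  set a := (A : Matrix (Fin 2) (Fin 2) ℂ)
  set b := (B : Matrix (Fin 2) (Fin 2) ℂ)
  set c := (C : Matrix (Fin 2) (Fin 2) ℂ)
  have e1 : a * b * (b.conjTranspose * a.conjTranspose) =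
      a * (b * b.conjTranspose) * a.conjTranspose := by simp only [mul_assoc]
  have e2 : a * c * (c.conjTranspose * a.conjTranspose) =
      a * (c * c.conjTranspose) * a.conjTranspose := by simp only [mul_assoc]
  rw [e1, e2]
  generalize b * b.conjTranspose = X
  generalize c * c.conjTranspose = Y
  rw [Matrix.mul_inv_rev, Matrix.mul_inv_rev]
  have : a.conjTranspose⁻¹ * (X⁻¹ * a⁻¹) * (a * Y * a.conjTranspose) =
      a.conjTranspose⁻¹ * (X⁻¹ * Y * a.conjTranspose) := by
    calc _ = a.conjTranspose⁻¹ * X⁻¹ * (a⁻¹ * a) * Y * a.conjTranspose := by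
          simp only [mul_assoc]
      _ = _ := by rw [Matrix.nonsing_inv_mul _ hA]; simp only [mul_assoc, one_mul]
  rw [this, Matrix.trace_mul_comm, mul_assoc, Matrix.mul_nonsing_inv _ hA', mul_one]

theorem base_coord : x0 base = 1 ∧ x1 base = 0 ∧ x2 base = 0 ∧ x3 base = 0 := by
  simp [base, x0, x1, x2, x3]

theorem coshDist_base (P : HypSpace) : coshDist base P = x0 P := by
  obtain ⟨h0, h1, h2, h3⟩ := base_coord
  simp [coshDist_eq, h0, h1, h2, h3]

theorem coshDist_comm (P Q : HypSpace) : coshDist P Q = coshDist Q P := by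
  simp only [coshDist_eq]; ring

/-- The hyperbolic metric, of constant curvature `-1`: `cosh d(P, Q) = ½ tr (X⁻¹ Y)`. -/
noncomputable instance : Dist HypSpace := ⟨fun P Q => Real.arcosh (coshDist P Q)⟩

theorem dist_def (P Q : HypSpace) : dist P Q = Real.arcosh (coshDist P Q) := rfl

theorem cosh_dist (P Q : HypSpace) : Real.cosh (dist P Q) = coshDist P Q :=
  Real.cosh_arcosh (one_le_coshDist P Q)

theorem dist_nonneg_aux (P Q : HypSpace) : 0 ≤ dist P Q :=
  Real.arcosh_nonneg (one_le_coshDist P Q)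

theorem sinh_dist_base (P : HypSpace) :
    Real.sinh (dist base P) = √(x1 P ^ 2 + x2 P ^ 2 + x3 P ^ 2) := by
  rw [dist_def, Real.sinh_arcosh (one_le_coshDist _ _), coshDist_base, mink_self]
  congr 1; ring

theorem dist_comm_aux (P Q : HypSpace) : dist P Q = dist Q P := by
  rw [dist_def, dist_def, coshDist_comm]

theorem dist_translate (A : SL2C) (P Q : HypSpace) :
    dist (translate A P) (translate A Q) = dist P Q := by
  rw [dist_def, dist_def, coshDist_translate]

theorem exists_translate_base (P : HypSpace) : ∃ A : SL2C, translate A P = base := by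
  obtain ⟨B, rfl⟩ := kappa_surjective P
  exact ⟨B⁻¹, by simp [base]⟩

theorem translate_injective (A : SL2C) : Function.Injective (translate A) := by
  intro P Q h
  obtain ⟨B, rfl⟩ := kappa_surjective P
  obtain ⟨C, rfl⟩ := kappa_surjective Q
  have := congrArg (translate A⁻¹) h
  simpa using this

theorem dist_triangle_base (P Q : HypSpace) : dist P Q ≤ dist base P + dist base Q := by
  have h1 := dist_nonneg_aux base P
  have h2 := dist_nonneg_aux base Q
  have h3 := dist_nonneg_aux P Q
  rw [← abs_of_nonneg h3, ← abs_of_nonneg (add_nonneg h1 h2), ← Real.cosh_le_cosh,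
    Real.cosh_add, cosh_dist, cosh_dist, cosh_dist, sinh_dist_base, sinh_dist_base,
    coshDist_base, coshDist_base, coshDist_eq]
  have := cauchy (x1 P) (x2 P) (x3 P) (x1 Q) (x2 Q) (x3 Q)
  have h := (abs_le.mp this).1
  linarith

theorem eq_of_dist_base (P : HypSpace) (h : dist base P = 0) : base = P := by
  have h' := sinh_dist_base P
  rw [h, Real.sinh_zero, eq_comm, Real.sqrt_eq_zero (by positivity)] at h'
  obtain ⟨-, h1, h2, h3⟩ := base_coord
  apply ext_coord
  · rw [h1]; nlinarith [sq_nonneg (x1 P), sq_nonneg (x2 P), sq_nonneg (x3 P)]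
  · rw [h2]; nlinarith [sq_nonneg (x1 P), sq_nonneg (x2 P), sq_nonneg (x3 P)]
  · rw [h3]; nlinarith [sq_nonneg (x1 P), sq_nonneg (x2 P), sq_nonneg (x3 P)]

noncomputable instance : MetricSpace HypSpace where
  dist_self P := by
    obtain ⟨A, hA⟩ := exists_translate_base P
    rw [← dist_translate A, hA, dist_def, coshDist_base, base_coord.1, Real.arcosh_zero]
  dist_comm := dist_comm_aux
  dist_triangle P Q R := by
    obtain ⟨A, hA⟩ := exists_translate_base Q
    rw [← dist_translate A P R, ← dist_translate A P Q, ← dist_translate A Q R, hA,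
      dist_comm_aux _ base]
    exact dist_triangle_base _ _
  eq_of_dist_eq_zero := by
    intro P Q h
    obtain ⟨A, hA⟩ := exists_translate_base P
    rw [← dist_translate A, hA] at h
    exact translate_injective A (hA.trans (eq_of_dist_base _ h))

/-- The point with given spatial Minkowski coordinates `sinh t • m`, for a unit vector `m`. -/
theorem exists_polar (m1 m2 m3 : ℝ) (hm : m1 ^ 2 + m2 ^ 2 + m3 ^ 2 = 1) (t : ℝ) :
    ∃ P : HypSpace, x0 P = Real.cosh t ∧ x1 P = Real.sinh t * m1 ∧ x2 P = Real.sinh t * m2 ∧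
      x3 P = Real.sinh t * m3 := by
  have hc : Real.cosh t = Real.cosh (t / 2) ^ 2 + Real.sinh (t / 2) ^ 2 := by
    rw [← Real.cosh_two_mul]; ring_nf
  have hs : Real.sinh t = 2 * Real.sinh (t / 2) * Real.cosh (t / 2) := by
    rw [← Real.sinh_two_mul]; ring_nf
  have hcs := Real.cosh_sq (t / 2)
  rw [hc, hs]
  generalize Real.cosh (t / 2) = c at *
  generalize Real.sinh (t / 2) = s at *
  obtain ⟨A, hA⟩ : ∃ A : SL2C, (A : Matrix (Fin 2) (Fin 2) ℂ) = !![((c + s * m3 : ℝ) : ℂ), ⟨s * m1, s * m2⟩; ⟨s * m1, -(s * m2)⟩,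
      ((c - s * m3 : ℝ) : ℂ)] := by
    refine ⟨⟨_, ?_⟩, rfl⟩
    rw [Matrix.det_fin_two_of]
    apply Complex.ext
    · simp; linear_combination hcs - s ^ 2 * hm
    · simp; ring
  refine ⟨kappa A, ?_, ?_, ?_, ?_⟩ <;>
    simp [x0, x1, x2, x3, hA, Matrix.mul_apply, Fin.sum_univ_two]
  · linear_combination s ^ 2 * hm
  · ring
  · ring
  · ring

/-- Every point lies on a geodesic through the base point `O`. A geodesic in its natural
parametrization is an isometric embedding `ℝ → ℍ³`. -/
theorem exists_geodesic (P : HypSpace) :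
    ∃ γ : ℝ → HypSpace, Isometry γ ∧ γ 0 = base ∧ γ (dist base P) = P := by
  obtain ⟨m1, m2, m3, hm, h1, h2, h3⟩ : ∃ m1 m2 m3 : ℝ, m1 ^ 2 + m2 ^ 2 + m3 ^ 2 = 1 ∧
      x1 P = Real.sinh (dist base P) * m1 ∧ x2 P = Real.sinh (dist base P) * m2 ∧
      x3 P = Real.sinh (dist base P) * m3 := by
    by_cases hP : base = P
    · subst hP
      obtain ⟨-, h1, h2, h3⟩ := base_coord
      exact ⟨0, 0, 1, by norm_num, by simp [h1], by simp [h2], by simp [h3]⟩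
    · have hpos : 0 < Real.sinh (dist base P) := Real.sinh_pos_iff.mpr (dist_pos.mpr hP)
      have hsq : Real.sinh (dist base P) ^ 2 = x1 P ^ 2 + x2 P ^ 2 + x3 P ^ 2 := by
        rw [sinh_dist_base, Real.sq_sqrt (by positivity)]
      refine ⟨x1 P / Real.sinh (dist base P), x2 P / Real.sinh (dist base P),
        x3 P / Real.sinh (dist base P), ?_, ?_, ?_, ?_⟩
      · rw [div_pow, div_pow, div_pow, ← add_div, ← add_div, ← hsq]
        exact div_self (by positivity)
      all_goals field_simp
  choose γ g0 g1 g2 g3 using exists_polar m1 m2 m3 hm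
  refine ⟨γ, ?_, ?_, ?_⟩
  · apply Isometry.of_dist_eq
    intro x y
    have : coshDist (γ x) (γ y) = Real.cosh |x - y| := by
      rw [coshDist_eq, g0, g1, g2, g3, g0, g1, g2, g3, Real.cosh_abs, Real.cosh_sub]
      linear_combination -(Real.sinh x * Real.sinh y) * hm
    rw [dist_def, this, Real.arcosh_cosh (abs_nonneg _), Real.dist_eq]
  · obtain ⟨-, h1', h2', h3'⟩ := base_coord
    apply ext_coord
    · rw [g1, h1']; simp
    · rw [g2, h2']; simp
    · rw [g3, h3']; simp
  · apply ext_coord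
    · rw [g1, h1]
    · rw [g2, h2]
    · rw [g3, h3]

/-- The geodesic through the base point `O` and another point is unique. -/
theorem geodesic_unique {γ δ : ℝ → HypSpace} (hγ : Isometry γ) (hδ : Isometry δ)
    (hγ0 : γ 0 = base) (hδ0 : δ 0 = base) {t : ℝ} (ht : t ≠ 0) (h : γ t = δ t) : γ = δ := by
  have key : ∀ η : ℝ → HypSpace, Isometry η → η 0 = base → ∀ x,
      Real.sinh t * x1 (η x) = Real.sinh x * x1 (η t) ∧
      Real.sinh t * x2 (η x) = Real.sinh x * x2 (η t) ∧
      Real.sinh t * x3 (η x) = Real.sinh x * x3 (η t) := by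
    intro η hη h0 x
    have c0 : ∀ y, x0 (η y) = Real.cosh y := by
      intro y
      rw [← coshDist_base, ← cosh_dist, ← h0, hη.dist_eq, Real.dist_eq, Real.cosh_abs]
      simp
    have c1 : coshDist (η t) (η x) = Real.cosh (t - x) := by
      rw [← cosh_dist, hη.dist_eq, Real.dist_eq, Real.cosh_abs]
    rw [coshDist_eq, c0, c0, Real.cosh_sub] at c1
    have mt := mink_self (η t)
    have mx := mink_self (η x)
    rw [c0, Real.cosh_sq] at mt mx
    have hsum : (Real.sinh t * x1 (η x) - Real.sinh x * x1 (η t)) ^ 2 +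
        (Real.sinh t * x2 (η x) - Real.sinh x * x2 (η t)) ^ 2 +
        (Real.sinh t * x3 (η x) - Real.sinh x * x3 (η t)) ^ 2 = 0 := by
      linear_combination -(Real.sinh t) ^ 2 * mx - (Real.sinh x) ^ 2 * mt +
        2 * Real.sinh t * Real.sinh x * c1
    refine ⟨?_, ?_, ?_⟩ <;> rw [← sub_eq_zero] <;> refine pow_eq_zero_iff (two_ne_zero) |>.mp ?_ <;>
      nlinarith [sq_nonneg (Real.sinh t * x1 (η x) - Real.sinh x * x1 (η t)),
        sq_nonneg (Real.sinh t * x2 (η x) - Real.sinh x * x2 (η t)),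
        sq_nonneg (Real.sinh t * x3 (η x) - Real.sinh x * x3 (η t))]
  funext x
  have hs : Real.sinh t ≠ 0 := by simpa [Real.sinh_eq_zero] using ht
  obtain ⟨a1, a2, a3⟩ := key γ hγ hγ0 x
  obtain ⟨b1, b2, b3⟩ := key δ hδ hδ0 x
  rw [h] at a1 a2 a3
  exact ext_coord (mul_left_cancel₀ hs (a1.trans b1.symm)) (mul_left_cancel₀ hs (a2.trans b2.symm))
    (mul_left_cancel₀ hs (a3.trans b3.symm))

/-- The rescaling `R_s` of `ℍ³` centred at `O` with factor `s⁻¹`: if `γ` is the naturally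
parametrized geodesic with `γ(0) = O` and `γ(t) = P`, where `t = d(O, P)`, then
`R_s(P) = γ(s⁻¹ t)`. -/
noncomputable def rescale (s : ℝ) (P : HypSpace) : HypSpace :=
  (exists_geodesic P).choose (s⁻¹ * dist base P)

theorem rescale_base (s : ℝ) : rescale s base = base := by
  have h := (exists_geodesic base).choose_spec.2.1
  simpa [rescale] using h

/-- The rescaling does not depend on the geodesic chosen in its definition. -/
theorem rescale_geodesic (s : ℝ) {γ : ℝ → HypSpace} (hγ : Isometry γ) (hγ0 : γ 0 = base)
    {t : ℝ} (ht : 0 ≤ t) : rescale s (γ t) = γ (s⁻¹ * t) := by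
  have hd : dist base (γ t) = t := by
    rw [← hγ0, hγ.dist_eq, Real.dist_eq, zero_sub, abs_neg, abs_of_nonneg ht]
  rcases ht.eq_or_lt with rfl | ht
  · rw [hγ0, rescale_base, mul_zero, hγ0]
  · obtain ⟨h1, h2, h3⟩ := (exists_geodesic (γ t)).choose_spec
    have hu := geodesic_unique h1 hγ h2 hγ0 ht.ne' ((congrArg _ hd.symm).trans h3)
    rw [rescale, hu, hd]

end HypSpace

/-- Holomorphic functions on a subset `U` of the complex submanifold `SL₂(ℂ)` of the space of
complex `2 × 2` matrices: locally restrictions of holomorphic functions of the four entries. -/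
def HolomorphicOnSL2C (F : SL2C → ℂ) (U : Set SL2C) : Prop :=
  ∀ A ∈ U, ∃ (W : Set (Matrix (Fin 2) (Fin 2) ℂ)) (G : Matrix (Fin 2) (Fin 2) ℂ → ℂ),
    IsOpen W ∧ (A : Matrix (Fin 2) (Fin 2) ℂ) ∈ W ∧ DifferentiableOn ℂ G W ∧
      ∀ B ∈ U, (B : Matrix (Fin 2) (Fin 2) ℂ) ∈ W → F B = G B

/-- Complex analytic surfaces in `SL₂(ℂ)`: subsets which near each of their points are the zero
set of one holomorphic function. -/
def IsAnalyticSurface (V : Set SL2C) : Prop :=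
  ∀ Z ∈ V, ∃ (U : Set SL2C) (F : SL2C → ℂ),
    IsOpen U ∧ Z ∈ U ∧ HolomorphicOnSL2C F U ∧ V ∩ U = {A ∈ U | F A = 0}

/-- A sequence of subsets goes to infinity if every ball around `O` is eventually disjoint from
its members. -/
def GoesToInfinity (A : ℕ → Set HypSpace) : Prop :=
  ∀ r : ℝ, 0 < r → ∀ᶠ n in atTop, Metric.ball HypSpace.base r ∩ A n = ∅

/-- Hausdorff convergence, on bounded regions, of subsets of `ℍ³` to a non-empty closed set `L`:
within each closed ball around `O`, each of `A n` and `L` is eventually contained in the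
`ε`-neighbourhood of the other. -/
def HausdorffConverges (A : ℕ → Set HypSpace) (L : Set HypSpace) : Prop :=
  IsClosed L ∧ L.Nonempty ∧ ∀ R : ℝ, 0 < R → ∀ ε : ℝ, 0 < ε → ∀ᶠ n in atTop,
    A n ∩ Metric.closedBall HypSpace.base R ⊆ Metric.thickening ε L ∧
      L ∩ Metric.closedBall HypSpace.base R ⊆ Metric.thickening ε (A n)

/-!
The rescaled images turn out to spread outward (`SpreadsOutward`): once one of them has a point at
distance `r` from `O`, it comes close to every point whose distance from `O` exceeds `r`. A closed
set that is a limit of such sets must be the complement of a ball (`limit_eq_compl_ball`). Moreover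
the sequence converges as soon as the distances of its members from `O` do (`hausdorffConverges`);
if the sequence does not go to infinity, these distances are bounded along a subsequence, so that
no compactness theorem for closed sets is needed.

Spreading outward (`eventually_exists_rescale_near`) comes from complex analysis. Let `Q` be a
point at distance `t` from `O`, rotated by `SU(2)` into the direction of the boundary point `∞` of
the upper half-space, and put `a = s t`. The horospheres centred at `∞` are images of holomorphic
curves in `SL₂(ℂ)`: the matrices `[[e^(τ/2), e^(a/2) ζ], [0, e^(-τ/2)]]` with `τ` fixed lie over the
horosphere of height `e^τ`. By the Iwasawa decomposition a given point `A` of the surface is, up to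
right multiplication by `SU(2)`, on one of these curves, and if `ϰ(A)` is closer to `O` than `a`,
then its parameter `ζ` is in the unit disc. Let `τ` increase to `a`. A hypersurface that meets the
first closed disc has to meet the boundary of one of the discs or the last disc: this is the
continuity principle of several complex variables (`IsAnalyticFamily.continuity_principle`), and it
follows from the identity theorem and the maximum principle. But the boundaries `|ζ| = 1` and the
last disc `τ = a` are at distance `a + O(1)` from `O`, in directions exponentially close to that
of `∞`, so `R_s` takes all of them close to `Q` when `s` is large.
-/

/-! ### Zero sets of families of holomorphic functions and the continuity principle -/

/-- A set `S ⊆ ℝ × ℂ` which near each of its points is the zero set of a function that is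
continuous in both variables and holomorphic in the second one: a family, over a real parameter,
of analytic subsets of `ℂ`. -/
def IsAnalyticFamily (S : Set (ℝ × ℂ)) : Prop :=
  ∀ p ∈ S, ∃ (N : Set (ℝ × ℂ)) (F : ℝ × ℂ → ℂ), IsOpen N ∧ p ∈ N ∧ ContinuousOn F N ∧
    (∀ τ : ℝ, DifferentiableOn ℂ (fun ζ => F (τ, ζ)) {ζ | (τ, ζ) ∈ N}) ∧
    ∀ q ∈ N, q ∈ S ↔ F q = 0

/-- Near each of its points, an analytic surface is cut out by one holomorphic function of the
matrix entries. -/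
theorem IsAnalyticSurface.exists_local_equation {V : Set SL2C} (hV : IsAnalyticSurface V)
    {Z : SL2C} (hZ : Z ∈ V) :
    ∃ (W : Set (Matrix (Fin 2) (Fin 2) ℂ)) (G : Matrix (Fin 2) (Fin 2) ℂ → ℂ),
      IsOpen W ∧ (Z : Matrix (Fin 2) (Fin 2) ℂ) ∈ W ∧ DifferentiableOn ℂ G W ∧
        ∀ B : SL2C, (B : Matrix (Fin 2) (Fin 2) ℂ) ∈ W → (B ∈ V ↔ G B = 0) := by
  obtain ⟨U, F, hU, hZU, hF, hVU⟩ := hV Z hZ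
  obtain ⟨W, G, hW, hZW, hG, hFG⟩ := hF Z hZU
  obtain ⟨W₀, hW₀, rfl⟩ := isOpen_induced_iff.mp hU
  refine ⟨W₀ ∩ W, G, hW₀.inter hW, ⟨hZU, hZW⟩, hG.mono inter_subset_right, ?_⟩
  rintro B ⟨hB₀, hBW⟩
  rw [← hFG B hB₀ hBW]
  have h := Set.ext_iff.mp hVU B
  simp only [mem_inter_iff, mem_ofPred_eq] at h
  exact ⟨fun hB => (h.mp ⟨hB, hB₀⟩).2, fun hB => (h.mpr ⟨hB₀, hB⟩).1⟩

/-- A family of holomorphic curves in `SL₂(ℂ)` meets an analytic surface in an analytic family. -/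
theorem IsAnalyticSurface.isAnalyticFamily_preimage {V : Set SL2C} (hV : IsAnalyticSurface V)
    {Ψ : ℝ × ℂ → SL2C} (hΨ : Continuous Ψ)
    (hΨ' : ∀ τ i j, Differentiable ℂ fun ζ => (Ψ (τ, ζ) : Matrix (Fin 2) (Fin 2) ℂ) i j) :
    IsAnalyticFamily (Ψ ⁻¹' V) := by
  intro p hp
  obtain ⟨W, G, hW, hpW, hG, hVG⟩ := hV.exists_local_equation hp
  have hc : Continuous fun q => (Ψ q : Matrix (Fin 2) (Fin 2) ℂ) :=
    continuous_induced_dom.comp hΨ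
  -- differentiability of `G` is read on the space of functions `Fin 2 → Fin 2 → ℂ`, which carries
  -- a norm, so that the chain rule applies
  have hG' : DifferentiableOn ℂ (E := Fin 2 → Fin 2 → ℂ) G W := hG
  refine ⟨(fun q => (Ψ q : Matrix (Fin 2) (Fin 2) ℂ)) ⁻¹' W, fun q => G (Ψ q), hW.preimage hc, hpW,
    ?_, fun τ => ?_, fun q hq => hVG (Ψ q) hq⟩
  · exact ContinuousOn.comp (β := Fin 2 → Fin 2 → ℂ) hG'.continuousOn hc.continuousOn
      fun q hq => hq
  · have hd : Differentiable ℂ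
        (fun ζ => (Ψ (τ, ζ) : Matrix (Fin 2) (Fin 2) ℂ) : ℂ → Fin 2 → Fin 2 → ℂ) :=
      differentiable_pi.mpr fun i => differentiable_pi.mpr fun j => hΨ' τ i j
    exact hG'.comp hd.differentiableOn fun ζ hζ => hζ

/-- If a fibre of a closed analytic family contains a neighbourhood of a point, then it is all
of `ℂ`, by the identity theorem. -/
theorem IsAnalyticFamily.mem_of_eventually {S : Set (ℝ × ℂ)} (hS : IsAnalyticFamily S)
    (hcl : IsClosed S) {τ : ℝ} {ζ₀ : ℂ} (h : ∀ᶠ ζ in 𝓝 ζ₀, (τ, ζ) ∈ S) (ζ : ℂ) : (τ, ζ) ∈ S := by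
  let I : Set ℂ := {ζ | ∀ᶠ ζ' in 𝓝 ζ, (τ, ζ') ∈ S}
  have hI : IsClopen I := by
    constructor
    · refine isClosed_of_closure_subset fun ζ₁ hζ₁ => ?_
      by_contra hn
      have hsub : I ⊆ {ζ | (τ, ζ) ∈ S} := fun ζ hζ => Eventually.self_of_nhds hζ
      have hfib : IsClosed {ζ : ℂ | (τ, ζ) ∈ S} := hcl.preimage (by fun_prop)
      have hmem : (τ, ζ₁) ∈ S := closure_minimal hsub hfib hζ₁
      obtain ⟨N, F, hN, hpN, -, hF, hSF⟩ := hS _ hmem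
      have hN' : {ζ : ℂ | (τ, ζ) ∈ N} ∈ 𝓝 ζ₁ :=
        (hN.preimage (by fun_prop : Continuous fun ζ : ℂ => (τ, ζ))).mem_nhds hpN
      have han := (hF τ).analyticAt hN'
      rcases han.eventually_eq_zero_or_eventually_ne_zero with h0 | h0
      · refine hn ?_
        filter_upwards [h0, hN'] with ζ h1 h2
        exact (hSF _ h2).mpr h1
      · have hfr : ∃ᶠ ζ in 𝓝[≠] ζ₁, ζ ∈ I :=
          mem_closure_ne_iff_frequently_within.mp (by rwa [sdiff_singleton_eq_self hn])
        obtain ⟨ζ, h1, h2, h3⟩ :=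
          (hfr.and_eventually (h0.and (mem_nhdsWithin_of_mem_nhds hN'))).exists
        exact h2 ((hSF _ h3).mp (hsub h1))
    · exact isOpen_iff_mem_nhds.mpr fun ζ hζ => eventually_eventually_nhds.mpr hζ
  have hu := hI.eq_univ ⟨ζ₀, h⟩
  exact Eventually.self_of_nhds (p := fun ζ => (τ, ζ) ∈ S) (hu.symm ▸ mem_univ ζ : ζ ∈ I)

/-- Stability of isolated zeros: if a point `ζ` is in a fibre of an analytic family, but no
neighbourhood of `ζ` is, then all nearby fibres have points close to `ζ`. -/
theorem IsAnalyticFamily.eventually_exists_mem {S : Set (ℝ × ℂ)} (hS : IsAnalyticFamily S)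
    {τ : ℝ} {ζ : ℂ} (hmem : (τ, ζ) ∈ S) (hiso : ¬ ∀ᶠ ζ' in 𝓝 ζ, (τ, ζ') ∈ S)
    {D : Set ℂ} (hD : D ∈ 𝓝 ζ) : ∀ᶠ τ' in 𝓝 τ, ∃ ζ' ∈ D, (τ', ζ') ∈ S := by
  obtain ⟨N, F, hN, hpN, hFc, hF, hSF⟩ := hS _ hmem
  have hN' : {ζ : ℂ | (τ, ζ) ∈ N} ∈ 𝓝 ζ :=
    (hN.preimage (by fun_prop : Continuous fun ζ : ℂ => (τ, ζ))).mem_nhds hpN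
  have hne : ∀ᶠ ζ' in 𝓝[≠] ζ, F (τ, ζ') ≠ 0 := by
    refine ((hF τ).analyticAt hN').eventually_eq_zero_or_eventually_ne_zero.resolve_left
      fun h0 => hiso ?_
    filter_upwards [h0, hN'] with ζ' h1 h2
    exact (hSF _ h2).mpr h1
  rw [eventually_nhdsWithin_iff] at hne
  obtain ⟨ρ, hρ, hball⟩ := Metric.nhds_basis_closedBall.eventually_iff.mp
    (hne.and (inter_mem hN' hD))
  have hFat : ∀ q ∈ N, ContinuousAt F q := fun q hq => hFc.continuousAt (hN.mem_nhds hq)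
  -- a lower bound for `|F|` on the circle of radius `ρ`
  obtain ⟨ζm, hζm, hmin⟩ := (isCompact_sphere ζ ρ).exists_isMinOn
    (NormedSpace.sphere_nonempty.mpr hρ.le) (f := fun ζ' => ‖F (τ, ζ')‖) (by
      intro ζ' hζ'
      have := hFat _ (hball (Metric.sphere_subset_closedBall hζ')).2.1
      exact (ContinuousAt.comp (f := fun ζ' : ℂ => (τ, ζ')) this
        (by fun_prop)).norm.continuousWithinAt)
  have hpos : 0 < ‖F (τ, ζm)‖ := norm_pos_iff.mpr
    ((hball (Metric.sphere_subset_closedBall hζm)).1 (Metric.ne_of_mem_sphere hζm hρ.ne'))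
  obtain ⟨c, hc0, hc⟩ := exists_between hpos
  have e1 : ∀ᶠ τ' in 𝓝 τ, ∀ ζ' ∈ Metric.sphere ζ ρ, c < ‖F (τ', ζ')‖ := by
    refine (isCompact_sphere ζ ρ).eventually_forall_of_forall_eventually fun ζ' hζ' => ?_
    exact (hFat _ (hball (Metric.sphere_subset_closedBall hζ')).2.1).norm.eventually
      (lt_mem_nhds (hc.trans_le (hmin hζ')))
  have e2 : ∀ᶠ τ' in 𝓝 τ, ∀ ζ' ∈ Metric.closedBall ζ ρ, (τ', ζ') ∈ N := by
    refine (isCompact_closedBall ζ ρ).eventually_forall_of_forall_eventually fun ζ' hζ' => ?_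
    exact hN.mem_nhds (hball hζ').2.1
  have e3 : ∀ᶠ τ' in 𝓝 τ, ‖F (τ', ζ)‖ < c := by
    have h0 : ‖F (τ, ζ)‖ < c := by rw [(hSF _ hpN).mp hmem, norm_zero]; exact hc0
    exact (ContinuousAt.comp (f := fun τ' : ℝ => (τ', ζ)) (hFat _ hpN)
      (by fun_prop)).norm.eventually (gt_mem_nhds h0)
  filter_upwards [e1, e2, e3] with τ' h1 h2 h3
  by_contra hno
  push Not at hno
  have hnz : ∀ ζ' ∈ Metric.closedBall ζ ρ, F (τ', ζ') ≠ 0 := fun ζ' hζ' h0 =>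
    hno ζ' (hball hζ').2.2 ((hSF _ (h2 ζ' hζ')).mpr h0)
  -- without zeros in the disc, the maximum principle for `1 / F` would force `|F| ≥ c` at `ζ`
  have hd : DiffContOnCl ℂ (fun ζ' => (F (τ', ζ'))⁻¹) (Metric.ball ζ ρ) := by
    refine DifferentiableOn.diffContOnCl ?_
    rw [closure_ball ζ hρ.ne']
    exact ((hF τ').mono fun ζ' hζ' => h2 ζ' hζ').inv hnz
  have hle := Complex.norm_le_of_forall_mem_frontier_norm_le Metric.isBounded_ball hd (C := c⁻¹)
    (fun ζ' hζ' => by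
      rw [frontier_ball ζ hρ.ne'] at hζ'
      rw [norm_inv]
      exact inv_anti₀ hc0 (h1 ζ' hζ').le)
    (subset_closure (Metric.mem_ball_self hρ))
  rw [norm_inv] at hle
  have h4 := (inv_le_inv₀ (norm_pos_iff.mpr (hnz ζ (Metric.mem_closedBall_self hρ.le))) hc0).mp hle
  linarith

/-- The continuity principle: follow the closed unit disc through a closed analytic family over
`[a, b]`. If the first disc meets the family, then so does the last disc or the boundary circle of
one of the discs. -/
theorem IsAnalyticFamily.continuity_principle {S : Set (ℝ × ℂ)} (hS : IsAnalyticFamily S)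
    (hcl : IsClosed S) {a b : ℝ} (hab : a ≤ b) {ζ₀ : ℂ} (hζ₀ : ‖ζ₀‖ ≤ 1) (hmem : (a, ζ₀) ∈ S) :
    ∃ τ ∈ Icc a b, ∃ ζ : ℂ, ‖ζ‖ ≤ 1 ∧ (τ, ζ) ∈ S ∧ (‖ζ‖ = 1 ∨ τ = b) := by
  by_contra! hno
  let K : Set ℝ := {τ | ∃ ζ : ℂ, ‖ζ‖ ≤ 1 ∧ (τ, ζ) ∈ S}
  have hK : IsClosed (K ∩ Icc a b) := by
    have : K ∩ Icc a b = Prod.fst '' (S ∩ Icc a b ×ˢ Metric.closedBall (0 : ℂ) 1) := by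
      ext τ
      constructor
      · rintro ⟨⟨ζ, h1, h2⟩, h3⟩
        exact ⟨(τ, ζ), ⟨h2, h3, by simpa using h1⟩, rfl⟩
      · rintro ⟨⟨τ', ζ⟩, ⟨h1, h2, h3⟩, rfl⟩
        exact ⟨⟨ζ, by simpa using h3, h1⟩, h2⟩
    rw [this]
    exact (((isCompact_Icc.prod (isCompact_closedBall 0 1)).inter_left hcl).image
      continuous_fst).isClosed
  have hsub : Icc a b ⊆ K := by
    refine hK.Icc_subset_of_forall_exists_gt ⟨ζ₀, hζ₀, hmem⟩ ?_
    rintro τ ⟨⟨ζ, hζ, hτζ⟩, hτ⟩ y hy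
    have hne := hno τ (Ico_subset_Icc_self hτ) ζ hζ hτζ
    have hiso : ¬ ∀ᶠ ζ' in 𝓝 ζ, (τ, ζ') ∈ S := fun h =>
      (hno τ (Ico_subset_Icc_self hτ) 1 (by simp) (hS.mem_of_eventually hcl h 1)).1 (by simp)
    have hD : Metric.ball (0 : ℂ) 1 ∈ 𝓝 ζ :=
      Metric.isOpen_ball.mem_nhds (by simpa using lt_of_le_of_ne hζ hne.1)
    have hev : ∀ᶠ τ' in 𝓝[>] τ, ∃ ζ' ∈ Metric.ball (0 : ℂ) 1, (τ', ζ') ∈ S :=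
      (hS.eventually_exists_mem hτζ hiso hD).filter_mono nhdsWithin_le_nhds
    obtain ⟨τ', ⟨ζ', h1, h2⟩, h3⟩ := (hev.and (Ioc_mem_nhdsGT hy)).exists
    exact ⟨τ', ⟨ζ', by simpa using (Metric.ball_subset_closedBall h1), h2⟩, h3⟩
  obtain ⟨ζ, h1, h2⟩ := hsub (right_mem_Icc.mpr hab)
  exact (hno b (right_mem_Icc.mpr hab) ζ h1 h2).2 rfl

namespace HypSpace

/-! ### Rescaling in Minkowski coordinates, and rotations -/

theorem dist_base_geodesic {γ : ℝ → HypSpace} (hγ : Isometry γ) (hγ0 : γ 0 = base) (t : ℝ) :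
    dist base (γ t) = |t| := by
  rw [← hγ0, hγ.dist_eq, Real.dist_eq, zero_sub, abs_neg]

theorem dist_base_rescale {s : ℝ} (hs : 0 < s) (P : HypSpace) :
    dist base (rescale s P) = s⁻¹ * dist base P := by
  obtain ⟨γ, hγ, hγ0, hP⟩ := exists_geodesic P
  have h : rescale s P = γ (s⁻¹ * dist base P) := by
    conv_lhs => rw [← hP]
    exact rescale_geodesic s hγ hγ0 dist_nonneg
  rw [h, dist_base_geodesic hγ hγ0, abs_of_nonneg (mul_nonneg (inv_nonneg.mpr hs.le) dist_nonneg)]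

theorem cosh_dist_base (P : HypSpace) : Real.cosh (dist base P) = x0 P := by
  rw [cosh_dist, coshDist_base]

/-- Along a geodesic through `O` the spatial Minkowski coordinates are proportional to `sinh`. -/
theorem sinh_mul_x3_geodesic {γ : ℝ → HypSpace} (hγ : Isometry γ) (hγ0 : γ 0 = base) (t x : ℝ) :
    Real.sinh t * x3 (γ x) = Real.sinh x * x3 (γ t) := by
  have c0 : ∀ y, x0 (γ y) = Real.cosh y := fun y => by
    rw [← cosh_dist_base, dist_base_geodesic hγ hγ0, Real.cosh_abs]
  have c1 : coshDist (γ t) (γ x) = Real.cosh (t - x) := by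
    rw [← cosh_dist, hγ.dist_eq, Real.dist_eq, Real.cosh_abs]
  rw [coshDist_eq, c0, c0, Real.cosh_sub] at c1
  have mt := mink_self (γ t)
  have mx := mink_self (γ x)
  rw [c0, Real.cosh_sq] at mt mx
  have hsum : (Real.sinh t * x1 (γ x) - Real.sinh x * x1 (γ t)) ^ 2 +
      (Real.sinh t * x2 (γ x) - Real.sinh x * x2 (γ t)) ^ 2 +
      (Real.sinh t * x3 (γ x) - Real.sinh x * x3 (γ t)) ^ 2 = 0 := by
    linear_combination -(Real.sinh t) ^ 2 * mx - (Real.sinh x) ^ 2 * mt +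
      2 * Real.sinh t * Real.sinh x * c1
  rw [← sub_eq_zero]
  refine pow_eq_zero_iff two_ne_zero |>.mp ?_
  nlinarith [sq_nonneg (Real.sinh t * x1 (γ x) - Real.sinh x * x1 (γ t)),
    sq_nonneg (Real.sinh t * x2 (γ x) - Real.sinh x * x2 (γ t)),
    sq_nonneg (Real.sinh t * x3 (γ x) - Real.sinh x * x3 (γ t))]

theorem sinh_mul_x3_rescale (s : ℝ) (P : HypSpace) :
    Real.sinh (dist base P) * x3 (rescale s P) = Real.sinh (s⁻¹ * dist base P) * x3 P := by
  obtain ⟨h1, h2, h3⟩ := (exists_geodesic P).choose_spec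
  have h := sinh_mul_x3_geodesic h1 h2 (dist base P) (s⁻¹ * dist base P)
  rw [h3] at h
  exact h

theorem isometry_translate (A : SL2C) : Isometry (translate A) :=
  Isometry.of_dist_eq (dist_translate A)

theorem kappa_mul_right (A : SL2C) {k : SL2C} (hk : k ∈ SU2) : kappa (A * k) = kappa A :=
  (QuotientGroup.eq.mpr (by simpa using hk) : (QuotientGroup.mk A : SL2C ⧸ SU2) = _).symm

theorem translate_base {k : SL2C} (hk : k ∈ SU2) : translate k base = base := by
  simpa [base] using kappa_mul_right 1 hk

theorem dist_base_translate {k : SL2C} (hk : k ∈ SU2) (P : HypSpace) :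
    dist base (translate k P) = dist base P := by
  conv_lhs => rw [← translate_base hk]
  exact dist_translate k _ _

/-- Rotations about `O` commute with the rescalings centred at `O`. -/
theorem rescale_translate (s : ℝ) {k : SL2C} (hk : k ∈ SU2) (P : HypSpace) :
    rescale s (translate k P) = translate k (rescale s P) := by
  obtain ⟨γ, hγ, hγ0, hP⟩ := exists_geodesic P
  have h1 := rescale_geodesic s hγ hγ0 (dist_nonneg (x := base) (y := P))
  have h2 := rescale_geodesic s ((isometry_translate k).comp hγ)
    (by simp [hγ0, translate_base hk]) (dist_nonneg (x := base) (y := P))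
  rw [hP] at h1
  simp only [Function.comp_apply, hP] at h2
  rw [h1, h2]

theorem herm_translate (A : SL2C) (P : HypSpace) :
    herm (translate A P) = (A : Matrix (Fin 2) (Fin 2) ℂ) * herm P *
      (A : Matrix (Fin 2) (Fin 2) ℂ).conjTranspose := by
  obtain ⟨B, rfl⟩ := kappa_surjective P
  simp only [translate_kappa, herm_kappa, Matrix.SpecialLinearGroup.coe_mul,
    Matrix.conjTranspose_mul, mul_assoc]

/-- The direction in which a point is seen from `O`. -/
theorem exists_direction (P : HypSpace) : ∃ m1 m2 m3 : ℝ, m1 ^ 2 + m2 ^ 2 + m3 ^ 2 = 1 ∧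
    x1 P = Real.sinh (dist base P) * m1 ∧ x2 P = Real.sinh (dist base P) * m2 ∧
    x3 P = Real.sinh (dist base P) * m3 := by
  by_cases hP : base = P
  · subst hP
    obtain ⟨-, h1, h2, h3⟩ := base_coord
    exact ⟨0, 0, 1, by norm_num, by simp [h1], by simp [h2], by simp [h3]⟩
  · have hpos : 0 < Real.sinh (dist base P) := Real.sinh_pos_iff.mpr (dist_pos.mpr hP)
    have hsq : Real.sinh (dist base P) ^ 2 = x1 P ^ 2 + x2 P ^ 2 + x3 P ^ 2 := by
      rw [sinh_dist_base, Real.sq_sqrt (by positivity)]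
    refine ⟨x1 P / Real.sinh (dist base P), x2 P / Real.sinh (dist base P),
      x3 P / Real.sinh (dist base P), ?_, ?_, ?_, ?_⟩
    · rw [div_pow, div_pow, div_pow, ← add_div, ← add_div, ← hsq]
      exact div_self (by positivity)
    all_goals field_simp

/-- The Hopf map is onto: every point of the unit sphere of `ℝ³` comes from a unit vector
`(α, β)` of `ℂ²`. -/
theorem exists_spinor (m1 m2 m3 : ℝ) (hm : m1 ^ 2 + m2 ^ 2 + m3 ^ 2 = 1) :
    ∃ α β : ℂ, Complex.normSq α + Complex.normSq β = 1 ∧ 2 * (α * star β) = ⟨m1, m2⟩ ∧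
      Complex.normSq α - Complex.normSq β = m3 := by
  by_cases h : m3 = -1
  · subst h
    have h1 : m1 = 0 := by nlinarith [sq_nonneg m1, sq_nonneg m2]
    have h2 : m2 = 0 := by nlinarith [sq_nonneg m1, sq_nonneg m2]
    exact ⟨0, 1, by simp, by simp [h1, h2, Complex.ext_iff], by simp⟩
  · have h3 : 0 < 1 + m3 := by
      have : 0 ≤ 1 + m3 := by nlinarith [sq_nonneg m1, sq_nonneg m2]
      exact lt_of_le_of_ne this fun h' => h (by linarith)
    obtain ⟨c, hc, hc2⟩ : ∃ c : ℝ, 0 < c ∧ 2 * c ^ 2 = 1 + m3 :=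
      ⟨√((1 + m3) / 2), by positivity, by rw [Real.sq_sqrt (by positivity)]; ring⟩
    have hβ : m1 / (2 * c) * (m1 / (2 * c)) + -(m2 / (2 * c)) * -(m2 / (2 * c)) = 1 - c ^ 2 := by
      field_simp
      linear_combination hm + (2 * c ^ 2 - 1 + m3) * hc2
    refine ⟨c, ⟨m1 / (2 * c), -(m2 / (2 * c))⟩, ?_, ?_, ?_⟩
    · rw [Complex.normSq_ofReal, Complex.normSq_mk, hβ]; ring
    · apply Complex.ext <;> simp <;> field_simp
    · rw [Complex.normSq_ofReal, Complex.normSq_mk, hβ]; linarith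

/-- The rotation group `SU(2)` acts transitively on the spheres centred at `O`: every point `Q` is
the image of the point in the direction of the third coordinate axis at the same distance
from `O`. -/
theorem exists_rotation (Q : HypSpace) : ∃ k ∈ SU2, ∃ P : HypSpace, Q = translate k P ∧
    x0 P = Real.cosh (dist base Q) ∧ x1 P = 0 ∧ x2 P = 0 ∧ x3 P = Real.sinh (dist base Q) := by
  obtain ⟨m1, m2, m3, hm, h1, h2, h3⟩ := exists_direction Q
  obtain ⟨P, p0, p1, p2, p3⟩ := exists_polar 0 0 1 (by norm_num) (dist base Q)
  simp only [mul_zero, mul_one] at p1 p2 p3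
  obtain ⟨α, β, hn, hc, hd⟩ := exists_spinor m1 m2 m3 hm
  have hdet : (!![α, -star β; β, star α] : Matrix (Fin 2) (Fin 2) ℂ).det = 1 := by
    rw [Matrix.det_fin_two_of]
    simp only [Complex.star_def, neg_mul, sub_neg_eq_add]
    rw [Complex.mul_conj, mul_comm, Complex.mul_conj, ← Complex.ofReal_add, hn, Complex.ofReal_one]
  refine ⟨⟨!![α, -star β; β, star α], hdet⟩, ?_, P, ?_, p0, p1, p2, p3⟩
  · refine Matrix.mem_unitaryGroup_iff.mpr ?_
    simp only [Complex.normSq_apply] at hn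
    ext i j
    fin_cases i <;> fin_cases j <;> apply Complex.ext <;>
      simp [Matrix.mul_apply, Fin.sum_univ_two] <;> linarith
  · have hP := herm_eq P
    rw [p0, p1, p2, p3] at hP
    have hc1 := congrArg Complex.re hc
    have hc2 := congrArg Complex.im hc
    simp at hc1 hc2
    simp only [Complex.normSq_apply] at hd
    have hh := herm_translate ⟨!![α, -star β; β, star α], hdet⟩ P
    rw [hP] at hh
    generalize Real.cosh (dist base Q) = c at hh
    generalize Real.sinh (dist base Q) = s at h1 h2 h3 hh
    apply ext_coord
    · rw [h1, x1, hh]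
      simp [Matrix.mul_apply, Fin.sum_univ_two]
      linear_combination (-s) * hc1
    · rw [h2, x2, hh]
      simp [Matrix.mul_apply, Fin.sum_univ_two]
      linear_combination (-s) * hc2
    · rw [h3, x3, hh]
      simp [Matrix.mul_apply, Fin.sum_univ_two]
      linear_combination (-s) * hd

/-! ### Horospherical discs -/

/-- For a fixed real number `a`, the matrices `[[e^(τ/2), e^(a/2) ζ], [0, e^(-τ/2)]]`. For fixed
`τ` they form a holomorphic curve in `SL₂(ℂ)` with parameter `ζ`, which `ϰ` maps to the horosphere
of height `e^τ` in the upper half-space; `ζ` is normalized so that, for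
`|τ| ≤ a`, the points with `|ζ| = 1` are at distance about `a` from `O`. -/
noncomputable def horoDisc (a : ℝ) (p : ℝ × ℂ) : SL2C :=
  ⟨!![((Real.exp (p.1 / 2) : ℝ) : ℂ), ((Real.exp (a / 2) : ℝ) : ℂ) * p.2;
      0, ((Real.exp (-p.1 / 2) : ℝ) : ℂ)], by
    rw [Matrix.det_fin_two_of, ← Complex.ofReal_mul, ← Real.exp_add]
    ring_nf
    simp⟩

theorem continuous_horoDisc (a : ℝ) : Continuous (horoDisc a) := by
  refine continuous_induced_rng.mpr (continuous_matrix fun i j => ?_)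
  fin_cases i <;> fin_cases j <;> simp <;> fun_prop

theorem differentiable_horoDisc (a τ : ℝ) (i j : Fin 2) :
    Differentiable ℂ fun ζ => (horoDisc a (τ, ζ) : Matrix (Fin 2) (Fin 2) ℂ) i j := by
  fin_cases i <;> fin_cases j <;> simp [horoDisc]
  fun_prop

theorem herm_kappa_horoDisc (a τ : ℝ) (ζ : ℂ) :
    herm (kappa (horoDisc a (τ, ζ))) =
      !![((Real.exp τ + Real.exp a * Complex.normSq ζ : ℝ) : ℂ),
          ((Real.exp ((a - τ) / 2) : ℝ) : ℂ) * ζ;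
        ((Real.exp ((a - τ) / 2) : ℝ) : ℂ) * star ζ, ((Real.exp (-τ) : ℝ) : ℂ)] := by
  have e1 : Real.exp τ = Real.exp (τ / 2) * Real.exp (τ / 2) := by rw [← Real.exp_add]; ring_nf
  have e2 : Real.exp a = Real.exp (a / 2) * Real.exp (a / 2) := by rw [← Real.exp_add]; ring_nf
  have e3 : Real.exp (-τ) = Real.exp (-τ / 2) * Real.exp (-τ / 2) := by
    rw [← Real.exp_add]; ring_nf
  have e4 : Real.exp ((a - τ) / 2) = Real.exp (a / 2) * Real.exp (-τ / 2) := by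
    rw [← Real.exp_add]; ring_nf
  have hA : (horoDisc a (τ, ζ) : Matrix (Fin 2) (Fin 2) ℂ) =
      !![((Real.exp (τ / 2) : ℝ) : ℂ), ((Real.exp (a / 2) : ℝ) : ℂ) * ζ;
        0, ((Real.exp (-τ / 2) : ℝ) : ℂ)] := rfl
  rw [e1, e2, e3, e4, herm_kappa, hA]
  generalize Real.exp (τ / 2) = t
  generalize Real.exp (a / 2) = u
  generalize Real.exp (-τ / 2) = v
  ext i j
  fin_cases i <;> fin_cases j <;> apply Complex.ext <;>
    simp [Matrix.mul_apply, Fin.sum_univ_two, Complex.normSq_apply] <;> ring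

theorem two_mul_x0_horoDisc (a τ : ℝ) (ζ : ℂ) :
    2 * x0 (kappa (horoDisc a (τ, ζ))) =
      Real.exp τ + Real.exp a * ‖ζ‖ ^ 2 + Real.exp (-τ) := by
  rw [x0, herm_kappa_horoDisc, Complex.sq_norm]
  simp only [Matrix.of_apply, Matrix.cons_val', Matrix.cons_val_zero, Matrix.cons_val_one,
    Matrix.cons_val_fin_one, Complex.ofReal_re]
  ring

theorem x0_sub_x3_horoDisc (a τ : ℝ) (ζ : ℂ) :
    x0 (kappa (horoDisc a (τ, ζ))) - x3 (kappa (horoDisc a (τ, ζ))) = Real.exp (-τ) := by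
  rw [x0, x3, herm_kappa_horoDisc]
  simp only [Matrix.of_apply, Matrix.cons_val', Matrix.cons_val_zero, Matrix.cons_val_one,
    Matrix.cons_val_fin_one, Complex.ofReal_re]
  ring

/-- The Iwasawa decomposition: the horospherical discs with a given parameter `a` fill `ℍ³`. -/
theorem exists_eq_kappa_horoDisc (a : ℝ) (P : HypSpace) :
    ∃ p : ℝ × ℂ, P = kappa (horoDisc a p) := by
  have hr : 0 < x0 P - x3 P := by
    nlinarith [mink_self P, x0_pos P, sq_nonneg (x1 P), sq_nonneg (x2 P)]
  obtain ⟨τ, hτ⟩ : ∃ τ : ℝ, Real.exp (-τ) = x0 P - x3 P :=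
    ⟨-Real.log (x0 P - x3 P), by rw [neg_neg, Real.exp_log hr]⟩
  obtain ⟨e, he⟩ : ∃ e : ℝ, e = Real.exp ((a - τ) / 2) := ⟨_, rfl⟩
  have he0 : e ≠ 0 := he ▸ (Real.exp_pos _).ne'
  have hq : ∀ z : ℂ, (e : ℂ) * ((e : ℂ)⁻¹ * z) = z := fun z => by
    rw [mul_inv_cancel_left₀ (Complex.ofReal_ne_zero.mpr he0)]
  let Q := kappa (horoDisc a (τ, (e : ℂ)⁻¹ * ⟨x1 P, x2 P⟩))
  have h01 : herm Q 0 1 = ⟨x1 P, x2 P⟩ := by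
    simp only [Q]
    rw [herm_kappa_horoDisc, ← he]
    simpa using hq _
  have h1 : x1 P = x1 Q := by rw [x1.eq_1 Q, h01]
  have h2 : x2 P = x2 Q := by rw [x2.eq_1 Q, h01]
  have h3 : x0 Q - x3 Q = x0 P - x3 P := (x0_sub_x3_horoDisc _ _ _).trans hτ
  -- the determinant condition `(x₀ - x₃) (x₀ + x₃) = 1 + x₁² + x₂²` gives the last coordinate
  have h4 : x0 Q + x3 Q = x0 P + x3 P := by
    apply mul_left_cancel₀ hr.ne'
    have mP := mink_self P
    have mQ := mink_self Q
    rw [← h1, ← h2] at mQ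
    linear_combination mQ - mP - (x0 Q + x3 Q) * h3
  exact ⟨_, ext_coord h1 h2 (by linarith)⟩

end HypSpace

namespace HypSpace

/-! ### Surfaces spread outward from any of their points -/

/-- If `P` is seen from `O` almost in the direction of the third axis, at rescaled distance close
to `t`, then `R_s(P)` is close to the point `Q` of that axis at distance `t`. -/
theorem coshDist_rescale_le {s : ℝ} (hs : 0 < s) {P Q : HypSpace} {t R η δ : ℝ} (ht : 0 ≤ t)
    (htR : t ≤ R) (h0 : x0 Q = Real.cosh t) (h1 : x1 Q = 0) (h2 : x2 Q = 0)
    (h3 : x3 Q = Real.sinh t) (hη : |s⁻¹ * dist base P - t| ≤ η) (hη1 : η ≤ 1) (hδ0 : 0 ≤ δ)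
    (hδ1 : δ < 1) (hP : x0 P - x3 P ≤ δ * x0 P) :
    coshDist (rescale s P) Q ≤ Real.cosh η + δ * Real.sinh (R + 1) ^ 2 := by
  have hd : 0 < dist base P := by
    refine lt_of_le_of_ne dist_nonneg fun h => ?_
    rw [← eq_of_dist_base P h.symm, base_coord.1, base_coord.2.2.2] at hP
    linarith
  have hd' : 0 ≤ s⁻¹ * dist base P := by positivity
  have hsd : 0 < Real.sinh (dist base P) := Real.sinh_pos_iff.mpr hd
  have hsd' : 0 ≤ Real.sinh (s⁻¹ * dist base P) := Real.sinh_nonneg_iff.mpr hd'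
  have hst : 0 ≤ Real.sinh t := Real.sinh_nonneg_iff.mpr ht
  have hx3 : (1 - δ) * Real.sinh (dist base P) ≤ x3 P := by
    have := mul_le_mul_of_nonneg_left (Real.sinh_lt_cosh (dist base P)).le (sub_nonneg.mpr hδ1.le)
    rw [cosh_dist_base] at this
    linarith
  have hX : (1 - δ) * Real.sinh (s⁻¹ * dist base P) ≤ x3 (rescale s P) := by
    refine le_of_mul_le_mul_left ?_ hsd
    rw [sinh_mul_x3_rescale]
    calc _ = Real.sinh (s⁻¹ * dist base P) * ((1 - δ) * Real.sinh (dist base P)) := by ring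
      _ ≤ _ := mul_le_mul_of_nonneg_left hx3 hsd'
  rw [coshDist_eq, h0, h1, h2, h3, ← cosh_dist_base (rescale s P), dist_base_rescale hs]
  set u := s⁻¹ * dist base P
  have hu : u ≤ R + 1 := by linarith [(abs_le.mp hη).2]
  have e1 : Real.cosh (u - t) ≤ Real.cosh η :=
    Real.cosh_le_cosh.mpr (hη.trans (le_abs_self η))
  rw [Real.cosh_sub] at e1
  have e2 : Real.sinh u * Real.sinh t ≤ Real.sinh (R + 1) ^ 2 := by
    rw [sq]
    exact mul_le_mul (Real.sinh_le_sinh.mpr hu) (Real.sinh_le_sinh.mpr (by linarith)) hst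
      (Real.sinh_nonneg_iff.mpr (by linarith))
  have e3 := mul_le_mul_of_nonneg_right hX hst
  have e4 := mul_le_mul_of_nonneg_left e2 hδ0
  nlinarith

/-- The discs through points within distance `D ≤ a` of `O` have their parameters `(τ, ζ)` in the
range `|τ| ≤ D`, `‖ζ‖ ≤ 1`. -/
theorem horoDisc_parameter_bounds {a D τ : ℝ} {ζ : ℂ}
    (hD : dist base (kappa (horoDisc a (τ, ζ))) = D) (hDa : D ≤ a) : |τ| ≤ D ∧ ‖ζ‖ ≤ 1 := by
  have hD0 : 0 ≤ D := hD ▸ dist_nonneg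
  have h := two_mul_x0_horoDisc a τ ζ
  rw [← cosh_dist_base, hD] at h
  have hc := Real.cosh_eq τ
  have hcD := Real.cosh_eq D
  have hζ : 0 ≤ Real.exp a * ‖ζ‖ ^ 2 := by positivity
  constructor
  · have : Real.cosh τ ≤ Real.cosh D := by linarith
    simpa [abs_of_nonneg hD0] using Real.cosh_le_cosh.mp this
  · have h1 := Real.one_le_cosh τ
    have h2 : Real.exp (-D) ≤ 1 := Real.exp_le_one_iff.mpr (by linarith)
    have h3 : Real.exp D ≤ Real.exp a := Real.exp_le_exp.mpr hDa
    have h4 : Real.exp a * ‖ζ‖ ^ 2 ≤ Real.exp a * 1 := by linarith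
    have h5 := le_of_mul_le_mul_left h4 (Real.exp_pos a)
    exact (sq_le_one_iff₀ (norm_nonneg ζ)).mp h5

/-- The boundary circles of the horospherical discs, and the last disc `τ = a`, lie at distance
about `a` from `O`. -/
theorem horoDisc_boundary_bounds {a τ : ℝ} {ζ : ℂ} (h1 : τ ≤ a) (h2 : -τ ≤ a) (hζ : ‖ζ‖ ≤ 1)
    (h : ‖ζ‖ = 1 ∨ τ = a) :
    Real.exp a ≤ 2 * x0 (kappa (horoDisc a (τ, ζ))) ∧
      |dist base (kappa (horoDisc a (τ, ζ))) - a| ≤ 2 := by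
  have hx := two_mul_x0_horoDisc a τ ζ
  have e1 := Real.exp_le_exp.mpr h1
  have e2 := Real.exp_le_exp.mpr h2
  have p1 := Real.exp_pos τ
  have p2 := Real.exp_pos (-τ)
  have pa := Real.exp_pos a
  have hζ0 : 0 ≤ Real.exp a * ‖ζ‖ ^ 2 := by positivity
  have hζ1 : Real.exp a * ‖ζ‖ ^ 2 ≤ Real.exp a :=
    mul_le_of_le_one_right pa.le (pow_le_one₀ (norm_nonneg ζ) hζ)
  have hlow : Real.exp a ≤ 2 * x0 (kappa (horoDisc a (τ, ζ))) := by
    rw [hx]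
    rcases h with h | h
    · rw [h]; linarith
    · rw [h] at p2 ⊢; linarith
  refine ⟨hlow, ?_⟩
  rw [← cosh_dist_base] at hlow hx
  set d := dist base (kappa (horoDisc a (τ, ζ)))
  have hd : Real.exp (-d) ≤ Real.exp d :=
    Real.exp_le_exp.mpr (by linarith [dist_nonneg (x := base) (y := kappa (horoDisc a (τ, ζ)))])
  have hd0 := Real.exp_pos (-d)
  rw [Real.cosh_eq] at hlow hx
  have two : 2 ≤ Real.exp 1 := by linarith [Real.add_one_le_exp (1 : ℝ)]
  have four : 4 ≤ Real.exp 2 := by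
    rw [show (2 : ℝ) = 1 + 1 by norm_num, Real.exp_add]; nlinarith
  have up : d ≤ a + 2 := by
    rw [← Real.exp_le_exp, Real.exp_add]; nlinarith
  have down : a ≤ d + 1 := by
    rw [← Real.exp_le_exp, Real.exp_add]; nlinarith [Real.exp_pos d]
  exact abs_le.mpr ⟨by linarith, by linarith⟩

/-- If a closed analytic surface has a point over the ball of radius `s (d(O, Q) - g)`, and `s` is
large, then some point of its rescaled image is close to `Q`. Rotate `Q` into the direction of the
centre of the horospheres, and apply the continuity principle to the horospherical discs, starting
from the disc through the given point: the surface meets the last disc or the boundary of one of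
the discs, and all of these rescale into a neighbourhood of `Q`. -/
theorem eventually_exists_rescale_near {R ε g : ℝ} (hε : 0 < ε) (hg : 0 < g) :
    ∀ᶠ s : ℝ in atTop, ∀ V : Set SL2C, IsClosed V → IsAnalyticSurface V →
      ∀ Q : HypSpace, dist base Q ≤ R → ∀ A ∈ V, dist base (kappa A) ≤ s * (dist base Q - g) →
        ∃ B ∈ V, dist (rescale s (kappa B)) Q < ε := by
  -- tolerances `η` for the rescaled distance from `O` and `δ` for the direction
  obtain ⟨η, hη0, hη1, hηε⟩ : ∃ η : ℝ, 0 < η ∧ η ≤ 1 ∧ η < ε :=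
    ⟨min 1 (ε / 2), by positivity, min_le_left _ _, (min_le_right _ _).trans_lt (by linarith)⟩
  have hcosh : Real.cosh η < Real.cosh ε := by
    rwa [Real.cosh_lt_cosh, abs_of_pos hη0, abs_of_pos hε]
  obtain ⟨δ, hδ0, hδ1, hδ⟩ : ∃ δ : ℝ, 0 < δ ∧ δ < 1 ∧
      Real.cosh η + δ * Real.sinh (R + 1) ^ 2 < Real.cosh ε := by
    have hM : 0 < Real.sinh (R + 1) ^ 2 + 1 := by positivity
    have hc : 0 < (Real.cosh ε - Real.cosh η) / (Real.sinh (R + 1) ^ 2 + 1) :=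
      div_pos (by linarith) hM
    refine ⟨min (1 / 2) ((Real.cosh ε - Real.cosh η) / (Real.sinh (R + 1) ^ 2 + 1)),
      by positivity, (min_le_left _ _).trans_lt (by norm_num), ?_⟩
    set δ := min (1 / 2) ((Real.cosh ε - Real.cosh η) / (Real.sinh (R + 1) ^ 2 + 1))
    have hδ0 : 0 < δ := lt_min (by norm_num) hc
    have h : δ * (Real.sinh (R + 1) ^ 2 + 1) ≤ Real.cosh ε - Real.cosh η :=
      (le_div_iff₀ hM).mp (min_le_right _ _)
    linarith
  filter_upwards [eventually_gt_atTop 0, eventually_ge_atTop (2 / η),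
    eventually_ge_atTop (2 / (δ * g))] with s hs hsη hsδ V hVc hVs Q hQR A hA hAQ
  obtain ⟨k, hk, Q', hQ, q0, q1, q2, q3⟩ := exists_rotation Q
  set t := dist base Q
  have ht : 0 ≤ t := dist_nonneg
  set a := s * t with ha
  -- write `A = k * horoDisc a p * c` with `c ∈ SU(2)`
  obtain ⟨⟨τ₀, ζ₀⟩, hp⟩ := exists_eq_kappa_horoDisc a (kappa (k⁻¹ * A))
  obtain ⟨c, hc, hkA⟩ : ∃ c ∈ SU2, A = k * horoDisc a (τ₀, ζ₀) * c := by
    refine ⟨(horoDisc a (τ₀, ζ₀))⁻¹ * (k⁻¹ * A), QuotientGroup.eq.mp hp.symm, ?_⟩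
    group
  have hsg : 0 < s * g := by positivity
  have hD : dist base (kappa (horoDisc a (τ₀, ζ₀))) = dist base (kappa A) := by
    rw [← hp, ← translate_kappa, dist_base_translate (inv_mem hk)]
  have hAa : dist base (kappa A) ≤ a - s * g := by rw [ha, ← mul_sub]; exact hAQ
  obtain ⟨hτ₀, hζ₀⟩ := horoDisc_parameter_bounds hD (by linarith)
  rw [abs_le] at hτ₀
  have hfam : IsAnalyticFamily ((fun q => k * horoDisc a q * c) ⁻¹' V) := by
    refine hVs.isAnalyticFamily_preimage
      ((continuous_const.mul (continuous_horoDisc a)).mul continuous_const) fun τ i j => ?_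
    have h := differentiable_horoDisc a τ
    simp only [Matrix.SpecialLinearGroup.coe_mul, Matrix.mul_apply]
    fun_prop
  obtain ⟨τ, ⟨hτ1, hτ2⟩, ζ, hζ, hB, hor⟩ := hfam.continuity_principle
    (hVc.preimage ((continuous_const.mul (continuous_horoDisc a)).mul continuous_const))
    (by linarith : τ₀ ≤ a) hζ₀ (by rw [mem_preimage, ← hkA]; exact hA)
  refine ⟨_, hB, ?_⟩
  rw [kappa_mul_right _ hc, ← translate_kappa, rescale_translate s hk, hQ, dist_translate]
  obtain ⟨hx, hd⟩ := horoDisc_boundary_bounds hτ2 (by linarith) hζ hor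
  have hx3 := x0_sub_x3_horoDisc a τ ζ
  set P := kappa (horoDisc a (τ, ζ))
  have hle : coshDist (rescale s P) Q' ≤ Real.cosh η + δ * Real.sinh (R + 1) ^ 2 := by
    refine coshDist_rescale_le hs ht hQR q0 q1 q2 q3 ?_ hη1 hδ0.le hδ1 ?_
    · have : s⁻¹ * dist base P - t = s⁻¹ * (dist base P - a) := by
        rw [ha, mul_sub, inv_mul_cancel_left₀ hs.ne']
      rw [this, abs_mul, abs_of_pos (inv_pos.mpr hs), inv_mul_le_iff₀ hs]
      exact hd.trans ((div_le_iff₀ hη0).mp hsη)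
    · have e1 : 2 / δ ≤ Real.exp (s * g) := by
        have h1 : 2 ≤ s * (δ * g) := (div_le_iff₀ (by positivity)).mp hsδ
        rw [div_le_iff₀ hδ0]
        nlinarith [Real.add_one_le_exp (s * g)]
      have e2 : Real.exp (-τ) * Real.exp (s * g) ≤ Real.exp a := by
        rw [← Real.exp_add]
        exact Real.exp_le_exp.mpr (by linarith)
      have e3 := mul_le_mul_of_nonneg_left e1 (Real.exp_pos (-τ)).le
      have e4 : Real.exp (-τ) * (2 / δ) ≤ 2 * x0 P := e3.trans (e2.trans hx)
      rw [hx3]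
      rw [mul_div_assoc', div_le_iff₀ hδ0] at e4
      linarith
  have hfin : Real.cosh (dist (rescale s P) Q') < Real.cosh ε := by
    rw [cosh_dist]; exact hle.trans_lt hδ
  rwa [Real.cosh_lt_cosh, abs_of_nonneg dist_nonneg, abs_of_pos hε] at hfin

end HypSpace

/-! ### Limits of sequences of sets that spread outward -/

open HypSpace

/-- A sequence of subsets of `ℍ³` spreads outward if, up to an error which vanishes in the limit,
each of its members that has a point at some distance from `O` comes near every point at larger
distance from `O`. -/
def SpreadsOutward (A : ℕ → Set HypSpace) : Prop :=
  ∀ R ε g : ℝ, 0 < ε → 0 < g → ∀ᶠ n in atTop, ∀ P ∈ A n, ∀ Q : HypSpace,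
    dist base Q ≤ R → dist base P + g ≤ dist base Q → ∃ P' ∈ A n, dist P' Q < ε

theorem SpreadsOutward.comp {A : ℕ → Set HypSpace} (hA : SpreadsOutward A) {φ : ℕ → ℕ}
    (hφ : StrictMono φ) : SpreadsOutward (A ∘ φ) := fun R ε g hε hg =>
  hφ.tendsto_atTop.eventually (hA R ε g hε hg)

theorem spreadsOutward_rescale {s : ℕ → ℝ} (hs_pos : ∀ n, 0 < s n) (hs : Tendsto s atTop atTop)
    {V : ℕ → Set SL2C} (hV_closed : ∀ n, IsClosed (V n))
    (hV_surface : ∀ n, IsAnalyticSurface (V n)) :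
    SpreadsOutward fun n => rescale (s n) '' (kappa '' V n) := by
  intro R ε g hε hg
  filter_upwards [hs.eventually (eventually_exists_rescale_near (R := R) hε hg)] with n hn
  rintro _ ⟨_, ⟨B, hB, rfl⟩, rfl⟩ Q hQR hQ
  rw [dist_base_rescale (hs_pos n), ← le_sub_iff_add_le, inv_mul_le_iff₀ (hs_pos n)] at hQ
  obtain ⟨C, hC, hCQ⟩ := hn (V n) (hV_closed n) (hV_surface n) Q hQR B hB hQ
  exact ⟨_, ⟨_, ⟨C, hC, rfl⟩, rfl⟩, hCQ⟩

namespace HypSpace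

/-- The point at a given distance from `O` on the ray from `O` through a given point. -/
theorem exists_radial (Q : HypSpace) {u : ℝ} (hu : 0 ≤ u) :
    ∃ Q' : HypSpace, dist base Q' = u ∧ dist Q Q' = |dist base Q - u| := by
  obtain ⟨γ, hγ, hγ0, hQ⟩ := exists_geodesic Q
  refine ⟨γ u, by rw [dist_base_geodesic hγ hγ0, abs_of_nonneg hu], ?_⟩
  conv_lhs => rw [← hQ]
  rw [hγ.dist_eq, Real.dist_eq]

end HypSpace

/-- The limit contains every point which is at least as far from `O` as the limit itself. -/
theorem SpreadsOutward.limit_eq_compl_ball {A : ℕ → Set HypSpace} (hA : SpreadsOutward A)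
    {L : Set HypSpace} (hL : HausdorffConverges A L) :
    ∃ r : ℝ, 0 ≤ r ∧ L = (Metric.ball base r)ᶜ := by
  obtain ⟨hcl, hne, hconv⟩ := hL
  refine ⟨Metric.infDist base L, Metric.infDist_nonneg, Subset.antisymm ?_ ?_⟩
  · intro Q hQ
    rw [mem_compl_iff, Metric.mem_ball, not_lt, dist_comm]
    exact Metric.infDist_le_dist_of_mem hQ
  · intro Q hQ
    rw [mem_compl_iff, Metric.mem_ball, not_lt, dist_comm] at hQ
    rw [← hcl.closure_eq, Metric.mem_closure_iff]
    intro ε hε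
    -- a point `Q'` slightly beyond `Q`, which is strictly further from `O` than some point of `L`
    obtain ⟨Q', hQ', hQQ'⟩ := exists_radial Q
      (add_nonneg dist_nonneg (by positivity : 0 ≤ ε / 4) : 0 ≤ dist base Q + ε / 4)
    rw [sub_add_cancel_left, abs_neg, abs_of_pos (by positivity)] at hQQ'
    obtain ⟨P, hP, hPd⟩ := (Metric.infDist_lt_iff hne).mp
      (by linarith : Metric.infDist base L < dist base Q + ε / 16)
    obtain ⟨n, h1, h2, h3⟩ := ((hconv (dist base P + 1) (by positivity) (ε / 16)
      (by positivity)).and ((hconv (dist base Q' + ε) (by positivity) (ε / 4) (by positivity)).and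
        (hA (dist base Q') (ε / 4) (ε / 16) (by positivity) (by positivity)))).exists
    obtain ⟨P₁, hP₁, hd₁⟩ := Metric.mem_thickening_iff.mp
      (h1.2 ⟨hP, by rw [Metric.mem_closedBall, dist_comm]; linarith⟩)
    obtain ⟨P₂, hP₂, hd₂⟩ := h3 P₁ hP₁ Q' le_rfl (by linarith [dist_triangle base P P₁])
    obtain ⟨b, hb, hd₃⟩ := Metric.mem_thickening_iff.mp (h2.1 ⟨hP₂, by
      rw [Metric.mem_closedBall, dist_comm]
      linarith [dist_triangle base Q' P₂, dist_comm Q' P₂]⟩)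
    exact ⟨b, hb, by linarith [dist_triangle Q Q' b, dist_triangle Q' P₂ b, dist_comm Q' P₂]⟩

/-- Points of `A n` are moved radially into the complement of the ball; conversely, a point of the
complement is pushed slightly outward to make it further from `O` than some point of `A n`. -/
theorem SpreadsOutward.hausdorffConverges {A : ℕ → Set HypSpace} (hA : SpreadsOutward A)
    (hne : ∀ n, (A n).Nonempty) {r : ℝ}
    (hr : Tendsto (fun n => Metric.infDist base (A n)) atTop (𝓝 r)) :
    HausdorffConverges A (Metric.ball base r)ᶜ := by
  have hr0 : 0 ≤ r := ge_of_tendsto' hr fun n => Metric.infDist_nonneg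
  refine ⟨Metric.isOpen_ball.isClosed_compl, ?_, fun R hR ε hε => ?_⟩
  · obtain ⟨Q, hQ, -⟩ := exists_radial base hr0
    exact ⟨Q, by rw [mem_compl_iff, Metric.mem_ball, not_lt, dist_comm, hQ]⟩
  · filter_upwards [hr.eventually (lt_mem_nhds (by linarith : r - ε < r)),
      hr.eventually (gt_mem_nhds (by linarith : r < r + ε / 8)),
      hA (R + ε / 2) (ε / 2) (ε / 8) (by positivity) (by positivity)] with n h1 h2 h3
    constructor
    · rintro P ⟨hP, -⟩
      have hd := Metric.infDist_le_dist_of_mem (x := base) hP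
      obtain ⟨Q, hQ, hPQ⟩ := exists_radial P (hr0.trans (le_max_right (dist base P) r))
      refine Metric.mem_thickening_iff.mpr ⟨Q, ?_, ?_⟩
      · rw [mem_compl_iff, Metric.mem_ball, not_lt, dist_comm, hQ]
        exact le_max_right _ _
      · rw [hPQ, abs_lt]
        rcases max_cases (dist base P) r with h | h <;> constructor <;> linarith
    · rintro Q ⟨hQ, hQR⟩
      rw [mem_compl_iff, Metric.mem_ball, not_lt, dist_comm] at hQ
      rw [Metric.mem_closedBall, dist_comm] at hQR
      -- a point `Q'` slightly beyond `Q`, which is strictly further from `O` than some point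
      -- of `A n`
      obtain ⟨Q', hQ', hQQ'⟩ := exists_radial Q
        (add_nonneg dist_nonneg (by positivity : 0 ≤ ε / 2) : 0 ≤ dist base Q + ε / 2)
      rw [sub_add_cancel_left, abs_neg, abs_of_pos (by positivity)] at hQQ'
      obtain ⟨P, hP, hPd⟩ := (Metric.infDist_lt_iff (hne n)).mp h2
      obtain ⟨P', hP', hd⟩ := h3 P hP Q' (by linarith) (by linarith)
      exact Metric.mem_thickening_iff.mpr
        ⟨P', hP', by linarith [dist_triangle Q Q' P', dist_comm Q' P']⟩

/-- Only the distances of the sets from `O` have to converge, and these are bounded along a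
subsequence unless the sequence goes to infinity. -/
theorem SpreadsOutward.exists_convergent_subsequence {A : ℕ → Set HypSpace}
    (hA : SpreadsOutward A) (hinf : ¬ GoesToInfinity A) :
    ∃ (φ : ℕ → ℕ) (L : Set HypSpace), StrictMono φ ∧ HausdorffConverges (A ∘ φ) L := by
  simp only [GoesToInfinity, not_forall, not_eventually, ← ne_eq, ← nonempty_iff_ne_empty] at hinf
  obtain ⟨r, -, hfreq⟩ := hinf
  obtain ⟨φ, hφ, hmeet⟩ := extraction_of_frequently_atTop hfreq
  have hmem : ∀ n, Metric.infDist base (A (φ n)) ∈ Icc 0 r := fun n => by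
    obtain ⟨P, hP, hPA⟩ := hmeet n
    rw [Metric.mem_ball, dist_comm] at hP
    exact ⟨Metric.infDist_nonneg, (Metric.infDist_le_dist_of_mem hPA).trans hP.le⟩
  obtain ⟨r', -, ψ, hψ, hlim⟩ := isCompact_Icc.tendsto_subseq hmem
  exact ⟨φ ∘ ψ, _, hφ.comp hψ, (hA.comp (hφ.comp hψ)).hausdorffConverges
    (fun n => (hmeet (ψ n)).mono inter_subset_right) hlim⟩

theorem mainTheorem1 (s : ℕ → ℝ) (hs_pos : ∀ n, 0 < s n) (hs : Tendsto s atTop atTop)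
    (V : ℕ → Set SL2C) (hV_closed : ∀ n, IsClosed (V n))
    (hV_surface : ∀ n, IsAnalyticSurface (V n)) :
    GoesToInfinity (fun n => HypSpace.rescale (s n) '' (HypSpace.kappa '' V n)) ∨
      ((∃ (φ : ℕ → ℕ) (L : Set HypSpace), StrictMono φ ∧
          HausdorffConverges
            (fun k => HypSpace.rescale (s (φ k)) '' (HypSpace.kappa '' V (φ k))) L) ∧
        ∀ (φ : ℕ → ℕ) (L : Set HypSpace), StrictMono φ →
          HausdorffConverges
            (fun k => HypSpace.rescale (s (φ k)) '' (HypSpace.kappa '' V (φ k))) L →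
          ∃ r : ℝ, 0 ≤ r ∧ L = (Metric.ball HypSpace.base r)ᶜ) := by
  have hA := spreadsOutward_rescale hs_pos hs hV_closed hV_surface
  by_cases hinf : GoesToInfinity (fun n => HypSpace.rescale (s n) '' (HypSpace.kappa '' V n))
  · exact Or.inl hinf
  · exact Or.inr ⟨hA.exists_convergent_subsequence hinf,
      fun φ L hφ hL => (hA.comp hφ).limit_eq_compl_ball hL⟩
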